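/- Let $\Sigma$ be a finite set of modes and $\gamma\neq 0$ a real number. For every $\sigma\in\Sigma$ let $A^\sigma\in\mathbb{R}^{n\times n}$, $B^\sigma\in\mathbb{R}^{n\times p}$, let $D^\sigma\in\mathbb{R}^{n\times n}$ be symmetric, and put $Q^\sigma=\gamma^{-2}B^\sigma (B^\sigma)^\top$. For $V^0:\mathbb{R}^n\to\mathbb{R}$, $t\ge 0$ and $x\in\mathbb{R}^n$ let $$S_t^\sigma[V^0](x)=\sup_{u\in L^2([0,\infty),\mathbb{R}^p)}\ \int_0^t \Big(\tfrac12\,\xi(s)^\top D^\sigma\xi(s)-\tfrac{\gamma^2}{2}|u(s)|^2\Big)ds+V^0(\xi(t)),\qquad \dot\xi=A^\sigma\xi+B^\sigma u,\quad \xi(0)=x,$$ be the Lax--Oleinik semigroup of the problem with constant mode $\sigma$, with values in $[-\infty,+\infty]$. For $\tau\ge 0$, let $\mathrm{ricc}_{\tau,\sigma}P_0=P(\tau)$, where $P$ is the solution on $[0,\tau]$, with symmetric values, of $$\dot P=(A^\sigma)^\top P+PA^\sigma+PQ^\sigma P+D^\sigma,\qquad P(0)=P_0;$$ it is defined for those $P_0$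 for which such a solution exists on all of $[0,\tau]$. Let $\mathcal W$ be a finite nonempty set with a map $\mathcal W\times\Sigma\to\mathcal W$, $(i,\sigma)\mapsto i\cdot\sigma$, and let $X=(X_i)_{i\in\mathcal W}$ be a family of real symmetric $n\times n$ matrices such that $\mathrm{ricc}_{\tau,\sigma}X_i$ is defined for all $i\in\mathcal W$, $\sigma\in\Sigma$. Suppose that $X\in M_\tau(X)$, i.e. that for every $j\in\mathcal W$ the matrix $X_j$ is a minimal upper bound, in the space of real symmetric $n\times n$ matrices with the Löwner order, of the set $$\{\mathrm{ricc}_{\tau,\sigma}X_i : i\in\mathcal W,\ \sigma\in\Sigma,\ i\cdot\sigma=j\}.$$ Let $V(z)=\sup_{i\in\mathcal W} z^\top X_i z$. Then $\tfrac12 V$ is sub-invariant for the Lax--Oleinik semigroups at the multiples of the time step $\tau$: for every integer $k\ge 0$ (in particular for $k=1$), $$\max_{\sigma\in\Sigma}\, S_{k\tau}^\sigma\big[\tfrac12 V\big](z)\ \le\ \tfrac12 V(z)\qquad\text{for all } z\in\mathbb{R}^n .$$ -/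

import Mathlib

open Set MeasureTheory Matrix
open scoped MatrixOrder

/-- Data of a switched linear-quadratic control problem with state space `ℝⁿ`, control space `ℝᵖ`
and set of modes `M`: the dynamics in mode `σ` is `ξ' = A σ ξ + B σ u`, and the running payoff is
`½ ξᵀ (D σ) ξ - (γ² / 2) |u|²`. -/
structure SwitchedLQ (n p : ℕ) (M : Type*) where
  A : M → Matrix (Fin n) (Fin n) ℝ
  B : M → Matrix (Fin n) (Fin p) ℝ
  D : M → Matrix (Fin n) (Fin n) ℝ
  γ : ℝ

namespace SwitchedLQ

variable {n p : ℕ} {M : Type*} (L : SwitchedLQ n p M)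

/-- `Q^σ = γ⁻² B^σ (B^σ)ᵀ`. -/
noncomputable def Q (σ : M) : Matrix (Fin n) (Fin n) ℝ :=
  (L.γ ^ 2)⁻¹ • (L.B σ * (L.B σ)ᵀ)

/-- The control space `𝒰 = L²([0, ∞), ℝᵖ)`, through representatives: all notions below depend on a
control only up to almost everywhere equality. -/
def IsControl (u : ℝ → Fin p → ℝ) : Prop :=
  MemLp u 2 (volume.restrict (Ici (0 : ℝ)))

/-- `ξ` is the (Carathéodory) solution on `[0, ∞)` of `ξ' = A^σ ξ + B^σ u`, `ξ(0) = x`.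
For a control `u` such a `ξ` exists, and it is unique on `[0, ∞)`. -/
def IsTrajectory (σ : M) (u : ℝ → Fin p → ℝ) (x : Fin n → ℝ) (ξ : ℝ → Fin n → ℝ) : Prop :=
  ContinuousOn ξ (Ici 0) ∧
    ∀ t, 0 ≤ t → ξ t = x + ∫ s in (0 : ℝ)..t, (L.A σ *ᵥ ξ s + L.B σ *ᵥ u s)

/-- The payoff `∫₀ᵗ ½ ξᵀ D^σ ξ - (γ² / 2) |u|² ds + V⁰(ξ(t))`. -/
noncomputable def payoff (σ : M) (t : ℝ) (V₀ : (Fin n → ℝ) → ℝ)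
    (u : ℝ → Fin p → ℝ) (ξ : ℝ → Fin n → ℝ) : ℝ :=
  (∫ s in (0 : ℝ)..t,
      (1 / 2 * (ξ s ⬝ᵥ (L.D σ *ᵥ ξ s)) - L.γ ^ 2 / 2 * (u s ⬝ᵥ u s))) + V₀ (ξ t)

/-- The Lax-Oleinik semigroup `S_t^σ` of the control problem with constant mode `σ`. The supremum is
taken in the extended reals, so that it is a genuine supremum also when it is `+∞`. -/
noncomputable def laxOleinik (σ : M) (t : ℝ) (V₀ : (Fin n → ℝ) → ℝ) (x : Fin n → ℝ) : EReal :=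
  ⨆ (u : ℝ → Fin p → ℝ) (ξ : ℝ → Fin n → ℝ) (_ : IsControl u) (_ : L.IsTrajectory σ u x ξ),
    ((L.payoff σ t V₀ u ξ : ℝ) : EReal)

/-- `P` is a solution on `[0, τ]`, with values in the symmetric matrices, of the Riccati equation
`P' = (A^σ)ᵀ P + P A^σ + P Q^σ P + D^σ`. -/
def IsRiccatiSolution (σ : M) (τ : ℝ) (P : ℝ → Matrix (Fin n) (Fin n) ℝ) : Prop :=
  ∀ s ∈ Icc (0 : ℝ) τ, (P s).IsSymm ∧
    HasDerivWithinAt P ((L.A σ)ᵀ * P s + P s * L.A σ + P s * L.Q σ * P s + L.D σ) (Icc 0 τ) s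

/-- The initial conditions from which the Riccati equation has a solution on all of `[0, τ]`. -/
def riccDomain (τ : ℝ) (σ : M) : Set (Matrix (Fin n) (Fin n) ℝ) :=
  {P₀ | ∃ P, L.IsRiccatiSolution σ τ P ∧ P 0 = P₀}

open Classical in
/-- The Riccati flow `ricc_{τ,σ} P₀ = P(τ)`, where `P` is the solution starting from `P₀`; it is only
meaningful on `riccDomain`, where `ricc_eq` shows that it does not depend on the choice made. -/
noncomputable def ricc (τ : ℝ) (σ : M) (P₀ : Matrix (Fin n) (Fin n) ℝ) :
    Matrix (Fin n) (Fin n) ℝ :=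
  if h : P₀ ∈ L.riccDomain τ σ then h.choose τ else 0

attribute [local instance] Matrix.linftyOpNormedRing Matrix.linftyOpNormedAlgebra in
theorem IsRiccatiSolution.eqOn {L : SwitchedLQ n p M} {σ : M} {τ : ℝ}
    {P R : ℝ → Matrix (Fin n) (Fin n) ℝ} (hP : L.IsRiccatiSolution σ τ P)
    (hR : L.IsRiccatiSolution σ τ R) (h0 : P 0 = R 0) : EqOn P R (Icc 0 τ) := by
  have cP : ContinuousOn P (Icc 0 τ) := fun s hs => (hP s hs).2.continuousWithinAt
  have cR : ContinuousOn R (Icc 0 τ) := fun s hs => (hR s hs).2.continuousWithinAt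
  obtain ⟨a, ha⟩ := isCompact_Icc.exists_bound_of_continuousOn cP
  obtain ⟨b, hb⟩ := isCompact_Icc.exists_bound_of_continuousOn cR
  set v : ℝ → Matrix (Fin n) (Fin n) ℝ → Matrix (Fin n) (Fin n) ℝ :=
    fun t E => (L.A σ)ᵀ * E + E * L.A σ + E * L.Q σ * P t + R t * L.Q σ * E with hv
  set c : ℝ := ‖(L.A σ)ᵀ‖ + ‖L.A σ‖ + ‖L.Q σ‖ * |a| + |b| * ‖L.Q σ‖ with hc
  have key : ∀ t ∈ Ico (0 : ℝ) τ, LipschitzOnWith c.toNNReal (v t) univ := by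
    intro t ht
    have ht' : t ∈ Icc (0 : ℝ) τ := ⟨ht.1, ht.2.le⟩
    refine LipschitzOnWith.of_dist_le_mul fun x _ y _ => ?_
    rw [dist_eq_norm, dist_eq_norm, Real.coe_toNNReal c (by positivity)]
    have e : v t x - v t y = (L.A σ)ᵀ * (x - y) + (x - y) * L.A σ
        + (x - y) * L.Q σ * P t + R t * L.Q σ * (x - y) := by
      simp only [hv]; noncomm_ring
    have h1 := norm_mul_le (L.A σ)ᵀ (x - y)
    have h2 := norm_mul_le (x - y) (L.A σ)
    have h3 : ‖(x - y) * L.Q σ * P t‖ ≤ ‖x - y‖ * ‖L.Q σ‖ * |a| :=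
      (norm_mul_le _ _).trans (mul_le_mul (norm_mul_le _ _) ((ha t ht').trans (le_abs_self a))
        (norm_nonneg _) (by positivity))
    have h4 : ‖R t * L.Q σ * (x - y)‖ ≤ |b| * ‖L.Q σ‖ * ‖x - y‖ :=
      (norm_mul_le _ _).trans (mul_le_mul_of_nonneg_right ((norm_mul_le _ _).trans
        (mul_le_mul_of_nonneg_right ((hb t ht').trans (le_abs_self b)) (norm_nonneg _)))
        (norm_nonneg _))
    rw [e]
    refine (norm_add₄_le).trans ?_
    rw [hc]
    linarith
  have hE : EqOn (fun s => P s - R s) (fun _ => 0) (Icc 0 τ) := by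
    refine ODE_solution_unique_of_mem_Icc_right (v := v) (s := fun _ => univ) key
      (cP.sub cR) ?_ (fun _ _ => trivial) continuousOn_const ?_ (fun _ _ => trivial) (by simp [h0])
    · intro t ht
      have ht' : t ∈ Icc (0 : ℝ) τ := ⟨ht.1, ht.2.le⟩
      have h := ((hP t ht').2.sub (hR t ht').2).mono_of_mem_nhdsWithin (Icc_mem_nhdsGE_of_mem ht)
      convert h using 1
      · rfl
      simp only [hv]
      noncomm_ring
    · intro t _
      have : v t 0 = 0 := by simp [hv]
      rw [this]
      exact hasDerivWithinAt_const _ _ _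
  intro s hs
  exact sub_eq_zero.1 (hE hs)

theorem ricc_eq {σ : M} {τ : ℝ} (hτ : 0 ≤ τ) {P : ℝ → Matrix (Fin n) (Fin n) ℝ}
    (hP : L.IsRiccatiSolution σ τ P) : L.ricc τ σ (P 0) = P τ := by
  have h : P 0 ∈ L.riccDomain τ σ := ⟨P, hP, rfl⟩
  rw [ricc, dif_pos h]
  exact h.choose_spec.1.eqOn hP h.choose_spec.2 ⟨hτ, le_rfl⟩

end SwitchedLQ

/-- The set `⋁ 𝒬` of minimal upper bounds of a set `𝒬` of matrices, in the space of symmetric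
matrices with the Löwner order (`P ≤ R` means that `R - P` is positive semidefinite). -/
def minimalUpperBounds {n : ℕ} (𝒬 : Set (Matrix (Fin n) (Fin n) ℝ)) :
    Set (Matrix (Fin n) (Fin n) ℝ) :=
  {X | Minimal (fun Y => Y.IsSymm ∧ ∀ R ∈ 𝒬, R ≤ Y) X}

/-- The multivalued map `M_τ`, whose `j`-th coordinate is
`⋁ {ricc_{τ,σ} X_i : i · σ = j}`; the transition map is `act i σ = i · σ`. -/
def SwitchedLQ.tropicalRiccati {n p : ℕ} {M W : Type*} (L : SwitchedLQ n p M)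
    (act : W → M → W) (τ : ℝ) (X : W → Matrix (Fin n) (Fin n) ℝ) (j : W) :
    Set (Matrix (Fin n) (Fin n) ℝ) :=
  minimalUpperBounds {R | ∃ i σ, act i σ = j ∧ R = L.ricc τ σ (X i)}

/-- The function `V(z) = sup_i zᵀ X_i z`. -/
noncomputable def supQuadratic {n : ℕ} {W : Type*} (X : W → Matrix (Fin n) (Fin n) ℝ)
    (z : Fin n → ℝ) : ℝ :=
  ⨆ i, z ⬝ᵥ (X i *ᵥ z)

/-! Fix a trajectory `ξ` in mode `σ` and a window from `a` to `b = a + τ`. If `P` solves the Riccati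
equation, put `φ t = ξ(t)ᵀ P(b - t) ξ(t)`. Because time is reversed, completing the square in the
control bounds the running payoff by `-φ'/2` almost everywhere (`runningPayoff_le`). As `φ` is
absolutely continuous, integration bounds the payoff on the window plus `½ ξ(b)ᵀ P(0) ξ(b)` by `½
ξ(a)ᵀ P(τ) ξ(a)`.

Start `P` at the `X i` that attains the maximum defining `V` at `ξ b`. Then `P τ = ricc_{τ,σ} X_i`
lies below `X (act i σ)`, whose quadratic form is at most `V`. So `V/2` decreases at least by the
payoff gained, and summing over successive windows gives the claim at `k τ`. -/

namespace SwitchedLQ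

variable {n p : ℕ} {M W : Type*} {L : SwitchedLQ n p M} {σ : M}
  {u : ℝ → Fin p → ℝ} {x : Fin n → ℝ} {ξ : ℝ → Fin n → ℝ}

/-! ### Integrability along controls and trajectories -/

theorem IsControl.memLp_Ioc (hu : IsControl u) {a b : ℝ} (ha : 0 ≤ a) (i : Fin p) :
    MemLp (fun s => u s i) 2 (volume.restrict (Ioc a b)) :=
  (MemLp.eval hu i).mono_measure
    (Measure.restrict_mono (fun _ hs => ha.trans hs.1.le) le_rfl)

theorem IsControl.intervalIntegrable_dotProduct_self (hu : IsControl u) {a b : ℝ} (ha : 0 ≤ a)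
    (hab : a ≤ b) : IntervalIntegrable (fun s => u s ⬝ᵥ u s) volume a b := by
  rw [intervalIntegrable_iff_integrableOn_Ioc_of_le hab]
  exact integrable_finsetSum _ fun i _ =>
    (hu.memLp_Ioc ha i).integrable_mul (hu.memLp_Ioc ha i)

theorem IsTrajectory.continuousOn_apply (hξ : L.IsTrajectory σ u x ξ) {a b : ℝ} (ha : 0 ≤ a)
    (hab : a ≤ b) (i : Fin n) : ContinuousOn (fun s => ξ s i) (uIcc a b) := by
  rw [uIcc_of_le hab]
  exact ((continuous_apply i).comp_continuousOn hξ.1).mono fun s hs => ha.trans hs.1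

theorem IsTrajectory.apply_zero (hξ : L.IsTrajectory σ u x ξ) : ξ 0 = x := by
  simpa using hξ.2 0 le_rfl

/-- The right-hand side of the state equation is integrable along a trajectory. -/
theorem IsTrajectory.intervalIntegrable (hu : IsControl u) (hξ : L.IsTrajectory σ u x ξ)
    {a b : ℝ} (ha : 0 ≤ a) (hab : a ≤ b) (i : Fin n) :
    IntervalIntegrable (fun s => (L.A σ *ᵥ ξ s + L.B σ *ᵥ u s) i) volume a b := by
  simp only [Pi.add_apply, mulVec, dotProduct]
  refine IntervalIntegrable.add ?_ ?_
  · exact ContinuousOn.intervalIntegrable (continuousOn_finsetSum _ fun j _ =>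
      continuousOn_const.mul (hξ.continuousOn_apply ha hab j))
  · rw [intervalIntegrable_iff_integrableOn_Ioc_of_le hab]
    exact integrable_finsetSum _ fun j _ =>
      ((hu.memLp_Ioc ha j).integrable one_le_two).const_mul _

theorem IsTrajectory.apply_eq (hu : IsControl u) (hξ : L.IsTrajectory σ u x ξ) {t : ℝ}
    (ht : 0 ≤ t) (i : Fin n) :
    ξ t i = x i + ∫ s in (0 : ℝ)..t, (L.A σ *ᵥ ξ s + L.B σ *ᵥ u s) i := by
  have hint : IntervalIntegrable (fun s => L.A σ *ᵥ ξ s + L.B σ *ᵥ u s) volume 0 t := by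
    rw [intervalIntegrable_iff_integrableOn_Ioc_of_le ht]
    refine Integrable.of_eval fun i => ?_
    rw [← IntegrableOn, ← intervalIntegrable_iff_integrableOn_Ioc_of_le ht]
    exact hξ.intervalIntegrable hu le_rfl ht i
  have h := congrFun (hξ.2 t ht) i
  rw [h, Pi.add_apply]
  congr 1
  exact ((ContinuousLinearMap.proj (R := ℝ) (φ := fun _ : Fin n => ℝ) i).intervalIntegral_comp_comm
    hint).symm

/-! ### The pointwise Hamilton-Jacobi inequality -/

/-- The running payoff. -/
noncomputable def runningPayoff (L : SwitchedLQ n p M) (σ : M) (y : Fin n → ℝ) (v : Fin p → ℝ) :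
    ℝ :=
  1 / 2 * (y ⬝ᵥ (L.D σ *ᵥ y)) - L.γ ^ 2 / 2 * (v ⬝ᵥ v)

theorem IsTrajectory.intervalIntegrable_runningPayoff (hu : IsControl u)
    (hξ : L.IsTrajectory σ u x ξ) {a b : ℝ} (ha : 0 ≤ a) (hab : a ≤ b) :
    IntervalIntegrable (fun s => L.runningPayoff σ (ξ s) (u s)) volume a b := by
  refine IntervalIntegrable.sub ?_ ((hu.intervalIntegrable_dotProduct_self ha hab).const_mul _)
  refine (ContinuousOn.intervalIntegrable ?_).const_mul _
  simp only [mulVec, dotProduct]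
  exact continuousOn_finsetSum _ fun i _ => (hξ.continuousOn_apply ha hab i).mul
    (continuousOn_finsetSum _ fun j _ => continuousOn_const.mul (hξ.continuousOn_apply ha hab j))

/-- Completion of the square: the Hamilton-Jacobi inequality for a quadratic form evolving under
the Riccati equation. -/
theorem runningPayoff_le (L : SwitchedLQ n p M) (hγ : L.γ ≠ 0) (σ : M)
    {R : Matrix (Fin n) (Fin n) ℝ} (hR : R.IsSymm) (y : Fin n → ℝ) (v : Fin p → ℝ) :
    L.runningPayoff σ y v ≤ -(1 / 2) *
      ((L.A σ *ᵥ y + L.B σ *ᵥ v) ⬝ᵥ (R *ᵥ y) + y ⬝ᵥ (R *ᵥ (L.A σ *ᵥ y + L.B σ *ᵥ v))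
        - y ⬝ᵥ (((L.A σ)ᵀ * R + R * L.A σ + R * L.Q σ * R + L.D σ) *ᵥ y)) := by
  set w : Fin p → ℝ := (L.B σ)ᵀ *ᵥ (R *ᵥ y) with hw
  have h1 : (L.A σ *ᵥ y) ⬝ᵥ (R *ᵥ y) = y ⬝ᵥ (((L.A σ)ᵀ * R) *ᵥ y) := by
    rw [← mulVec_mulVec, dotProduct_mulVec y, vecMul_transpose]
  have h2 : (L.B σ *ᵥ v) ⬝ᵥ (R *ᵥ y) = v ⬝ᵥ w := by
    rw [hw, dotProduct_mulVec v, vecMul_transpose]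
  have h3 : y ⬝ᵥ (R *ᵥ (L.B σ *ᵥ v)) = v ⬝ᵥ w := by
    rw [← h2, dotProduct_mulVec, ← mulVec_transpose, hR.eq, dotProduct_comm]
  have h4 : y ⬝ᵥ ((R * L.Q σ * R) *ᵥ y) = (L.γ ^ 2)⁻¹ * (w ⬝ᵥ w) := by
    rw [← mulVec_mulVec, ← mulVec_mulVec, dotProduct_mulVec, ← mulVec_transpose, hR.eq, Q,
      smul_mulVec, dotProduct_smul, smul_eq_mul, ← mulVec_mulVec, dotProduct_mulVec (R *ᵥ y),
      ← mulVec_transpose]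
  have h5 : y ⬝ᵥ (R *ᵥ (L.A σ *ᵥ y)) = y ⬝ᵥ ((R * L.A σ) *ᵥ y) := by rw [mulVec_mulVec]
  -- Half of this square is the gap in the inequality; it vanishes at the optimal feedback `v = γ⁻²
  -- w`.
  have h6 : 0 ≤ (L.γ • v - L.γ⁻¹ • w) ⬝ᵥ (L.γ • v - L.γ⁻¹ • w) :=
    Finset.sum_nonneg fun i _ => mul_self_nonneg _
  have h7 : (L.γ • v - L.γ⁻¹ • w) ⬝ᵥ (L.γ • v - L.γ⁻¹ • w) =
      L.γ ^ 2 * (v ⬝ᵥ v) - 2 * (v ⬝ᵥ w) + (L.γ ^ 2)⁻¹ * (w ⬝ᵥ w) := by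
    simp only [sub_dotProduct, dotProduct_sub, smul_dotProduct, dotProduct_smul, smul_eq_mul,
      dotProduct_comm w v]
    field_simp
    ring
  simp only [runningPayoff, add_dotProduct, dotProduct_add, mulVec_add, add_mulVec, h1, h2, h3,
    h4, h5]
  linarith

/-! ### Quadratic forms along absolutely continuous curves -/

/-- The derivative of a time-dependent quadratic form along a curve. -/
theorem hasDerivAt_quadratic {y : ℝ → Fin n → ℝ} {y' : Fin n → ℝ}
    {R : ℝ → Matrix (Fin n) (Fin n) ℝ} {R' : Matrix (Fin n) (Fin n) ℝ} {s : ℝ}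
    (hy : ∀ i, HasDerivAt (fun t => y t i) (y' i) s)
    (hR : ∀ i j, HasDerivAt (fun t => R t i j) (R' i j) s) :
    HasDerivAt (fun t => y t ⬝ᵥ (R t *ᵥ y t))
      (y' ⬝ᵥ (R s *ᵥ y s) + y s ⬝ᵥ (R s *ᵥ y') + y s ⬝ᵥ (R' *ᵥ y s)) s := by
  have h : HasDerivAt (fun t => ∑ i, y t i * ∑ j, R t i j * y t j)
      (∑ i, (y' i * ∑ j, R s i j * y s j + y s i * ∑ j, (R' i j * y s j + R s i j * y' j))) s :=
    HasDerivAt.fun_sum fun i _ => (hy i).fun_mul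
      (HasDerivAt.fun_sum fun j _ => (hR i j).fun_mul (hy j))
  refine h.congr_deriv ?_
  simp only [dotProduct, mulVec, Finset.sum_add_distrib, mul_add]
  ring

theorem absolutelyContinuousOnInterval_sum {ι : Type*} (S : Finset ι) {f : ι → ℝ → ℝ} {a b : ℝ}
    (hf : ∀ i ∈ S, AbsolutelyContinuousOnInterval (f i) a b) :
    AbsolutelyContinuousOnInterval (fun t => ∑ i ∈ S, f i t) a b := by
  classical
  induction S using Finset.induction_on with
  | empty =>
    simpa using (LipschitzWith.const (α := ℝ) (0 : ℝ)).lipschitzOnWith.absolutelyContinuousOnInterval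
  | insert i S hi ih =>
    simp only [Finset.sum_insert hi]
    exact (hf i (by simp)).fun_add (ih fun j hj => hf j (by simp [hj]))

/-- With merely L² controls, trajectories need not be differentiable everywhere; absolute
continuity, stable under finite sums and products, is what recovers a quadratic form from its a.e.
derivative. -/
theorem absolutelyContinuousOnInterval_quadratic {y : ℝ → Fin n → ℝ}
    {R : ℝ → Matrix (Fin n) (Fin n) ℝ} {a b : ℝ}
    (hy : ∀ i, AbsolutelyContinuousOnInterval (fun t => y t i) a b)
    (hR : ∀ i j, AbsolutelyContinuousOnInterval (fun t => R t i j) a b) :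
    AbsolutelyContinuousOnInterval (fun t => y t ⬝ᵥ (R t *ᵥ y t)) a b := by
  change AbsolutelyContinuousOnInterval (fun t => ∑ i, y t i * ∑ j, R t i j * y t j) a b
  exact absolutelyContinuousOnInterval_sum _ fun i _ => (hy i).fun_mul
    (absolutelyContinuousOnInterval_sum _ fun j _ => (hR i j).fun_mul (hy j))

theorem IsRiccatiSolution.hasDerivWithinAt_apply {τ : ℝ} {P : ℝ → Matrix (Fin n) (Fin n) ℝ}
    (hP : L.IsRiccatiSolution σ τ P) {s : ℝ} (hs : s ∈ Icc 0 τ) (i j : Fin n) :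
    HasDerivWithinAt (fun t => P t i j)
      (((L.A σ)ᵀ * P s + P s * L.A σ + P s * L.Q σ * P s + L.D σ) i j) (Icc 0 τ) s :=
  hasDerivWithinAt_pi.1 (hasDerivWithinAt_pi.1 (hP s hs).2 i) j

/-- The entries of a solution of the Riccati equation are Lipschitz. -/
theorem IsRiccatiSolution.exists_lipschitzOnWith {τ : ℝ} {P : ℝ → Matrix (Fin n) (Fin n) ℝ}
    (hP : L.IsRiccatiSolution σ τ P) (i j : Fin n) :
    ∃ K, LipschitzOnWith K (fun t => P t i j) (Icc 0 τ) := by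
  have hc : ContinuousOn P (Icc 0 τ) := 
    continuousOn_pi.2 fun i => continuousOn_pi.2 fun j => fun s hs =>
      (hP.hasDerivWithinAt_apply hs i j).continuousWithinAt
  have hc' : ContinuousOn (fun s =>
      ((L.A σ)ᵀ * P s + P s * L.A σ + P s * L.Q σ * P s + L.D σ) i j) (Icc 0 τ) := by
    rw [continuousOn_iff_continuous_domRestrict] at hc ⊢
    exact Continuous.matrix_elem ((((continuous_const.matrix_mul hc).add
      (hc.matrix_mul continuous_const)).add
      ((hc.matrix_mul continuous_const).matrix_mul hc)).add continuous_const) i j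
  obtain ⟨C, hC⟩ := isCompact_Icc.exists_bound_of_continuousOn hc'
  refine ⟨C.toNNReal, (convex_Icc 0 τ).lipschitzOnWith_of_nnnorm_hasDerivWithin_le
    (fun s hs => hP.hasDerivWithinAt_apply hs i j) fun s hs => ?_⟩
  rw [← NNReal.coe_le_coe, coe_nnnorm]
  exact (hC s hs).trans (Real.le_coe_toNNReal C)

/-! ### Verification over one time step -/

/-- Verification inequality on a time window: the Riccati flow bounds the payoff of every
trajectory. -/
theorem IsTrajectory.integral_runningPayoff_add_le (hγ : L.γ ≠ 0) (hu : IsControl u)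
    (hξ : L.IsTrajectory σ u x ξ) {τ : ℝ} (hτ : 0 ≤ τ) {P : ℝ → Matrix (Fin n) (Fin n) ℝ}
    (hP : L.IsRiccatiSolution σ τ P) {a : ℝ} (ha : 0 ≤ a) :
    (∫ s in a..(a + τ), L.runningPayoff σ (ξ s) (u s))
        + 1 / 2 * (ξ (a + τ) ⬝ᵥ (P 0 *ᵥ ξ (a + τ)))
      ≤ 1 / 2 * (ξ a ⬝ᵥ (P τ *ᵥ ξ a)) := by
  set b := a + τ with hb
  have hab : a ≤ b := by linarith
  have hb0 : 0 ≤ b := ha.trans hab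
  set g : ℝ → Fin n → ℝ := fun s => L.A σ *ᵥ ξ s + L.B σ *ᵥ u s with hg
  have hgi : ∀ i, IntervalIntegrable (fun s => g s i) volume 0 b := fun i =>
    hξ.intervalIntegrable hu le_rfl hb0 i
  -- The integral equation holds only for `t ≥ 0`; `y` is its right-hand side, defined for all `t`,
  -- so two-sided derivatives make sense.
  set y : ℝ → Fin n → ℝ := fun t i => x i + ∫ s in (0 : ℝ)..t, g s i with hy
  have hyξ : ∀ t, 0 ≤ t → y t = ξ t := fun t ht => funext fun i => (hξ.apply_eq hu ht i).symm
  have hsub : uIcc a b ⊆ uIcc 0 b := by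
    rw [uIcc_of_le hab, uIcc_of_le hb0]; exact Icc_subset_Icc_left ha
  have hyac : ∀ i, AbsolutelyContinuousOnInterval (fun t => y t i) a b := fun i =>
    ((LipschitzWith.const (α := ℝ) (x i)).lipschitzOnWith.absolutelyContinuousOnInterval).fun_add
      (((hgi i).absolutelyContinuousOnInterval_intervalIntegral left_mem_uIcc).mono hsub)
  have hyd : ∀ i, ∀ᵐ s, s ∈ uIcc 0 b → HasDerivAt (fun t => y t i) (g s i) s := fun i => by
    filter_upwards [(hgi i).ae_hasDerivAt_integral] with s hs hs'
    exact (hs hs' 0 left_mem_uIcc).const_add _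
  set R : ℝ → Matrix (Fin n) (Fin n) ℝ := fun s => P (b - s) with hR
  have hmaps : MapsTo (fun s => b - s) (uIcc a b) (Icc 0 τ) := fun s hs => by
    rw [uIcc_of_le hab] at hs
    exact ⟨by linarith [hs.2], by linarith [hs.1]⟩
  have hRac : ∀ i j, AbsolutelyContinuousOnInterval (fun t => R t i j) a b := fun i j => by
    obtain ⟨K, hK⟩ := hP.exists_lipschitzOnWith i j
    exact (hK.comp (LipschitzWith.of_dist_le_mul (K := 1) fun s t => by
      rw [Real.dist_eq, Real.dist_eq, abs_sub_comm s t, sub_sub_sub_cancel_left]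
      simp).lipschitzOnWith hmaps).absolutelyContinuousOnInterval
  -- By time reversal the derivative of `R` is `-R'`.
  set R' : ℝ → Matrix (Fin n) (Fin n) ℝ := fun s =>
    (L.A σ)ᵀ * R s + R s * L.A σ + R s * L.Q σ * R s + L.D σ with hR'
  have hRd : ∀ s ∈ Ioo a b, ∀ i j, HasDerivAt (fun t => R t i j) ((-R' s) i j) s := by
    intro s hs i j
    have h0 : b - s ∈ Ioo 0 τ := ⟨by linarith [hs.2], by linarith [hs.1]⟩
    have h1 := (hP.hasDerivWithinAt_apply (Ioo_subset_Icc_self h0) i j).hasDerivAt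
      (Icc_mem_nhds h0.1 h0.2)
    exact (h1.comp_const_sub b s)
  have hφ := absolutelyContinuousOnInterval_quadratic hyac hRac
  set φ : ℝ → ℝ := fun t => y t ⬝ᵥ (R t *ᵥ y t) with hφdef
  have key : ∫ s in a..b, L.runningPayoff σ (ξ s) (u s)
      ≤ ∫ s in a..b, -(1 / 2) * deriv φ s := by
    refine intervalIntegral.integral_mono_ae_restrict hab
      (hξ.intervalIntegrable_runningPayoff hu ha hab) (hφ.intervalIntegrable_deriv.const_mul _) ?_
    rw [Filter.EventuallyLE, ae_restrict_iff' measurableSet_Icc]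
    -- The endpoints form a null set; `P` has only one-sided derivatives there.
    have hna : ∀ᵐ s : ℝ, s ≠ a := by simp [ae_iff]
    have hnb : ∀ᵐ s : ℝ, s ≠ b := by simp [ae_iff]
    filter_upwards [ae_all_iff.2 hyd, hna, hnb] with s hs hsa hsb hsI
    have hs0 : 0 ≤ s := ha.trans hsI.1
    have hsO : s ∈ Ioo a b := ⟨lt_of_le_of_ne hsI.1 (Ne.symm hsa), lt_of_le_of_ne hsI.2 hsb⟩
    have hd := hasDerivAt_quadratic
      (fun i => hs i (hsub (by rwa [uIcc_of_le hab]))) (hRd s hsO)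
    have hsymm : (R s).IsSymm := (hP (b - s) (hmaps (by rwa [uIcc_of_le hab]))).1
    rw [hd.deriv, hyξ s hs0, neg_mulVec, dotProduct_neg, ← sub_eq_add_neg]
    exact L.runningPayoff_le hγ σ hsymm (ξ s) (u s)
  rw [intervalIntegral.integral_const_mul, hφ.integral_deriv_eq_sub] at key
  have e1 : φ a = ξ a ⬝ᵥ (P τ *ᵥ ξ a) := by
    simp only [hφdef, hR, hyξ a ha, hb, add_sub_cancel_left]
  have e2 : φ b = ξ b ⬝ᵥ (P 0 *ᵥ ξ b) := by simp only [hφdef, hR, hyξ b hb0, sub_self]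
  rw [e1, e2] at key
  linarith

/-! ### Dynamic programming over successive steps -/

variable [Finite W] [Nonempty W]

/-- One time step of the dynamic programming inequality for `V`. -/
theorem IsTrajectory.integral_runningPayoff_add_supQuadratic_le (hγ : L.γ ≠ 0) {act : W → M → W}
    {τ : ℝ} (hτ : 0 ≤ τ) {X : W → Matrix (Fin n) (Fin n) ℝ}
    (hdom : ∀ i σ, X i ∈ L.riccDomain τ σ) (hX : ∀ j, X j ∈ L.tropicalRiccati act τ X j)
    (hu : IsControl u) (hξ : L.IsTrajectory σ u x ξ) {a : ℝ} (ha : 0 ≤ a) :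
    (∫ s in a..(a + τ), L.runningPayoff σ (ξ s) (u s)) + 1 / 2 * supQuadratic X (ξ (a + τ))
      ≤ 1 / 2 * supQuadratic X (ξ a) := by
  -- The index is chosen at the end of the window, since the Riccati flow runs backwards along the
  -- trajectory.
  obtain ⟨i, hi⟩ := exists_eq_ciSup_of_finite (f := fun i => ξ (a + τ) ⬝ᵥ (X i *ᵥ ξ (a + τ)))
  obtain ⟨P, hP, hP0⟩ := hdom i σ
  have h1 := hξ.integral_runningPayoff_add_le hγ hu hτ hP ha
  obtain ⟨⟨-, hub⟩, -⟩ := hX (act i σ)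
  have h2 : P τ ≤ X (act i σ) := hub _ ⟨i, σ, rfl, by rw [← hP0, L.ricc_eq hτ hP]⟩
  have h3 : 0 ≤ ξ a ⬝ᵥ ((X (act i σ) - P τ) *ᵥ ξ a) := by
    simpa using (Matrix.le_iff.1 h2).dotProduct_mulVec_nonneg (ξ a)
  have h4 : ξ a ⬝ᵥ (X (act i σ) *ᵥ ξ a) ≤ supQuadratic X (ξ a) :=
    le_ciSup (f := fun i => ξ a ⬝ᵥ (X i *ᵥ ξ a)) (Set.finite_range _).bddAbove (act i σ)
  have h5 : supQuadratic X (ξ (a + τ)) = ξ (a + τ) ⬝ᵥ (P 0 *ᵥ ξ (a + τ)) := by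
    rw [hP0]; exact hi.symm
  rw [sub_mulVec, dotProduct_sub] at h3
  rw [h5]
  linarith

/-- The one-step bound holds for windows starting at any `a ≥ 0`, so it telescopes along a single
trajectory, without restarting it at each step. -/
theorem IsTrajectory.payoff_supQuadratic_le (hγ : L.γ ≠ 0) {act : W → M → W}
    {τ : ℝ} (hτ : 0 ≤ τ) {X : W → Matrix (Fin n) (Fin n) ℝ}
    (hdom : ∀ i σ, X i ∈ L.riccDomain τ σ) (hX : ∀ j, X j ∈ L.tropicalRiccati act τ X j)
    (hu : IsControl u) (hξ : L.IsTrajectory σ u x ξ) (k : ℕ) :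
    L.payoff σ (k * τ) (fun y => 1 / 2 * supQuadratic X y) u ξ ≤ 1 / 2 * supQuadratic X x := by
  change (∫ s in (0 : ℝ)..(k * τ), L.runningPayoff σ (ξ s) (u s))
    + 1 / 2 * supQuadratic X (ξ (k * τ)) ≤ _
  induction k with
  | zero => simp [hξ.apply_zero]
  | succ k ih =>
    have hk : 0 ≤ (k : ℝ) * τ := by positivity
    have h := hξ.integral_runningPayoff_add_supQuadratic_le hγ hτ hdom hX hu hk
    have e : ((k + 1 : ℕ) : ℝ) * τ = k * τ + τ := by push_cast; ring
    rw [e, ← intervalIntegral.integral_add_adjacent_intervals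
      (hξ.intervalIntegrable_runningPayoff hu le_rfl hk)
      (hξ.intervalIntegrable_runningPayoff hu hk (by linarith))]
    linarith

end SwitchedLQ

theorem mainTheorem4 {n p : ℕ} {M W : Type*} [Finite M] [Finite W] [Nonempty W]
    (L : SwitchedLQ n p M) (hγ : L.γ ≠ 0) (hD : ∀ σ, (L.D σ).IsSymm)
    (act : W → M → W) (τ : ℝ) (hτ : 0 ≤ τ)
    (X : W → Matrix (Fin n) (Fin n) ℝ)
    (hdom : ∀ i σ, X i ∈ L.riccDomain τ σ)
    (hX : ∀ j, X j ∈ L.tropicalRiccati act τ X j) :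
    ∀ (k : ℕ) (z : Fin n → ℝ),
      (⨆ σ, L.laxOleinik σ (k * τ) (fun x => 1 / 2 * supQuadratic X x) z)
        ≤ ((1 / 2 * supQuadratic X z : ℝ) : EReal) := by
  intro k z
  refine iSup_le fun σ => iSup_le fun u => iSup_le fun ξ => iSup_le fun hu => iSup_le fun hξ => ?_
  exact EReal.coe_le_coe_iff.2 (hξ.payoff_supQuadratic_le hγ hτ hdom hX hu k)
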